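/- Let $n\in\mathbb N$ and $0<\alpha<n$. A Young function is a convex, left-continuous function $\Phi:[0,\infty)\to[0,\infty]$ with $\lim_{r\to0+}\Phi(r)=\Phi(0)=0$ and $\lim_{r\to\infty}\Phi(r)=\infty$; $\mathcal Y$ is the set of Young functions with $0<\Phi(r)<\infty$ for $0<r<\infty$; and $\Phi\in\nabla_2$ means that for some $C>1$, $\Phi(r)\le\frac1{2C}\Phi(Cr)$ for all $r\ge0$. For a function $F:[0,\infty)\to[0,\infty]$ put $F^{-1}(s)=\inf\{r\ge0:F(r)>s\}$ (with $\inf\emptyset=\infty$). A function $\Phi$ dominates $Q$ globally if there is $c>0$ with $Q(s)\le\Phi(cs)$ for all $s\ge0$. For $1<P<\infty$, $P'=P/(P-1)$ and a Young function $\Psi$ let $$\mathcal B_P(s)=\int_0^s\frac{\Psi(t)}{t^{1+P'}}\,dt,\qquad \Theta_P(s)=\int_0^s r^{P'-1}\big(\mathcal B_P^{-1}(r^{P'})\big)^{P'}dr ,$$ and let $\Psi_P(s)=\sup_{r\ge0}\,(rs-\Theta_P(r))$ be the Young conjugate of $\Theta_P$ (so that $\Theta_P=\widetilde{\Psi_P}$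 whenever $\Psi(t)/t^{1+P'}$ is integrable near $0$). Let $\Phi,\Psi$ be Young functions with $\Phi\in\mathcal Y$, and consider the condition that for some $C>0$ $$r^{-\alpha/n}\,\Phi^{-1}(r)\le C\,\Psi^{-1}(r)\quad\text{for all } r>0. \qquad (*)$$ 1) $\Phi$ dominates globally the function $Q:[0,\infty)\to[0,\infty)$ whose inverse is $Q^{-1}(r)=r^{\alpha/n}\Psi^{-1}(r)$ if and only if $(*)$ holds. 2) If moreover $\Phi\in\nabla_2$, then the following condition is equivalent to $(*)$: there is $\varepsilon>0$ with $\int_0^{\varepsilon}\frac{\Psi(t)}{t^{1+n/(n-\alpha)}}\,dt<\infty$, and $\Phi$ dominates $\Psi_{n/\alpha}$ globally. -/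

import Mathlib

open Set Filter Topology MeasureTheory
open scoped NNReal ENNReal

noncomputable section

namespace Orlicz

/-- Young functions `Φ : [0,∞) → [0,∞]`: convex, left-continuous,
`lim_{r → 0+} Φ r = Φ 0 = 0` and `lim_{r → ∞} Φ r = ∞`. -/
structure IsYoung (Φ : ℝ≥0 → ℝ≥0∞) : Prop where
  convex : ConvexOn ℝ≥0 univ Φ
  leftCont : ∀ r, ContinuousWithinAt Φ (Iic r) r
  map_zero : Φ 0 = 0
  tendsto_zero : Tendsto Φ (𝓝[>] 0) (𝓝 0)
  tendsto_top : Tendsto Φ atTop (𝓝 ⊤)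

/-- The class `𝒴` of Young functions with `0 < Φ r < ∞` for `0 < r < ∞`. -/
def IsYoungY (Φ : ℝ≥0 → ℝ≥0∞) : Prop :=
  IsYoung Φ ∧ ∀ r, 0 < r → 0 < Φ r ∧ Φ r < ⊤

/-- The inverse `F⁻¹(s) = inf {r ≥ 0 : F r > s}` for `0 ≤ s ≤ ∞` (with `inf ∅ = ∞`). -/
def inverse (F : ℝ≥0 → ℝ≥0∞) (s : ℝ≥0∞) : ℝ≥0∞ :=
  ⨅ (r : ℝ≥0) (_ : s < F r), (r : ℝ≥0∞)

/-- The Young conjugate `sup {r s - Φ s : s ≥ 0}`. The subtraction is truncated at `0`, which does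
not change the supremum when `Φ 0 = 0`, since `s = 0` already contributes the value `0`. -/
def conjugate (Φ : ℝ≥0 → ℝ≥0∞) (r : ℝ≥0) : ℝ≥0∞ :=
  ⨆ s : ℝ≥0, ((r : ℝ≥0∞) * (s : ℝ≥0∞) - Φ s)

/-- The `∇₂`-condition: `Φ r ≤ Φ (C r) / (2 C)` for all `r ≥ 0` and some `C > 1`. -/
def Nabla2 (Φ : ℝ≥0 → ℝ≥0∞) : Prop :=
  ∃ C : ℝ≥0, 1 < C ∧ ∀ r : ℝ≥0, Φ r ≤ (1 / (2 * (C : ℝ≥0∞))) * Φ (C * r)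

/-- `Ψ` dominates `Φ` globally: `Φ s ≤ Ψ (c s)` for all `s ≥ 0` and some `c > 0`. -/
def DominatesGlobally (Ψ Φ : ℝ≥0 → ℝ≥0∞) : Prop :=
  ∃ c : ℝ≥0, 0 < c ∧ ∀ s : ℝ≥0, Φ s ≤ Ψ (c * s)

/-- The function `Q` whose inverse is `r ↦ r ^ a * Ψ⁻¹(r)`. For a Young function `Ψ` and `a > 0`
the latter is an increasing bijection of `[0,∞)`, so that `Q` is its inverse in the usual sense. -/
def Q (a : ℝ) (Ψ : ℝ≥0 → ℝ≥0∞) (t : ℝ≥0) : ℝ≥0∞ :=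
  inverse (fun r : ℝ≥0 => (r : ℝ≥0∞) ^ a * inverse Ψ r) t

/-- `𝓑_P(s) = ∫₀ˢ Ψ(t) / t^(1 + P') dt`, where `P' = P / (P - 1)`. -/
def calB (P : ℝ) (Ψ : ℝ≥0 → ℝ≥0∞) (s : ℝ≥0) : ℝ≥0∞ :=
  ∫⁻ t in Ioo (0 : ℝ) s, Ψ t.toNNReal / ENNReal.ofReal t ^ (1 + P.conjExponent)

/-- `s ↦ ∫₀ˢ r^(P' - 1) (𝓑_P⁻¹(r^P'))^P' dr`, the Young conjugate of `Ψ_P`. -/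
def tildePsiP (P : ℝ) (Ψ : ℝ≥0 → ℝ≥0∞) (s : ℝ≥0) : ℝ≥0∞ :=
  ∫⁻ r in Ioo (0 : ℝ) s, ENNReal.ofReal r ^ (P.conjExponent - 1) *
    (inverse (calB P Ψ) (ENNReal.ofReal r ^ P.conjExponent)) ^ P.conjExponent

/-- The function `Ψ_P` with Young conjugate `tildePsiP P Ψ`, recovered from it by conjugating
once more. -/
def PsiP (P : ℝ) (Ψ : ℝ≥0 → ℝ≥0∞) : ℝ≥0 → ℝ≥0∞ :=
  conjugate (tildePsiP P Ψ)

/-- Cianchi's weak-type condition: `Φ` dominates globally the function `Q` with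
`Q⁻¹(r) = r^(α/n) Ψ⁻¹(r)`. -/
def CianchiWeak (n : ℕ) (α : ℝ) (Φ Ψ : ℝ≥0 → ℝ≥0∞) : Prop :=
  DominatesGlobally Φ (Q (α / n) Ψ)

/-- Cianchi's strong-type condition: `Ψ(t) / t^(1 + n/(n-α))` is integrable near `0`, and `Φ`
dominates globally `Ψ_{n/α}`. -/
def CianchiStrong (n : ℕ) (α : ℝ) (Φ Ψ : ℝ≥0 → ℝ≥0∞) : Prop :=
  (∃ ε : ℝ, 0 < ε ∧
    ∫⁻ t in Ioo (0 : ℝ) ε, Ψ t.toNNReal / ENNReal.ofReal t ^ (1 + n / (n - α)) < ⊤) ∧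
  DominatesGlobally Φ (PsiP (n / α) Ψ)

/-- The condition `r^(-α/n) Φ⁻¹(r) ≤ C Ψ⁻¹(r)` for all `r > 0`, with `C > 0` independent of `r`. -/
def AdamsCondition (n : ℕ) (α : ℝ) (Φ Ψ : ℝ≥0 → ℝ≥0∞) : Prop :=
  ∃ C : ℝ≥0, 0 < C ∧ ∀ r : ℝ≥0, 0 < r →
    (r : ℝ≥0∞) ^ (-(α / n)) * inverse Φ r ≤ C * inverse Ψ r

end Orlicz

end

namespace Orlicz

/-! Write `q = P'` with `P = n/α`, so `q/P = q - 1`, and `Θ = tildePsiP P Ψ`.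

The weak equivalence only inverts functions: `Φ` dominating `Q` amounts to `Φ⁻¹ ≤ C Q⁻¹`, which is
(*) solved for `Φ⁻¹`.

For the strong condition, monotonicity of the integrand gives `Θ(r) ≤ (r 𝓑⁻¹(r^q))^q ≤ Θ(2r)`.
Testing the conjugate at one point then yields `x ≤ Ψ_P(16 x^(1/P) Ψ⁻¹(x))` (`le_PsiP`), so
domination of `Ψ_P` by `Φ` forces (*), without ∇₂ or integrability.

Conversely, iterating ∇₂ downwards makes `Φ` decay geometrically. Through (*) this passes to `Ψ`,
with `Ψ(t D⁻ᵏ) ≤ y (2D)^(-qk)` for suitable `t` and `y`. The pieces of `𝓑(t)` then form a convergent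
geometric series (`calB_le`). This gives integrability near `0` and a lower bound on `𝓑⁻¹`, hence on
`Θ`, hence an upper bound on `Ψ_P` (`PsiP_le`). -/

theorem IsYoung.map_mul_le {Φ : ℝ≥0 → ℝ≥0∞} (h : IsYoung Φ) {l : ℝ≥0} (hl : l ≤ 1) (r : ℝ≥0) :
    Φ (l * r) ≤ l * Φ r := by
  have := h.convex.2 (mem_univ r) (mem_univ 0) (zero_le : 0 ≤ l) (zero_le : 0 ≤ 1 - l)
    (add_tsub_cancel_of_le hl)
  simpa [h.map_zero, ENNReal.smul_def] using this

theorem IsYoung.map_le_div_mul {Φ : ℝ≥0 → ℝ≥0∞} (h : IsYoung Φ) {r s : ℝ≥0} (hs : 0 < s)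
    (hrs : r ≤ s) : Φ r ≤ ((r / s : ℝ≥0) : ℝ≥0∞) * Φ s := by
  have := h.map_mul_le (div_le_one_of_le₀ hrs zero_le) s
  rwa [div_mul_cancel₀ _ hs.ne'] at this

theorem IsYoung.monotone {Φ : ℝ≥0 → ℝ≥0∞} (h : IsYoung Φ) : Monotone Φ := by
  intro r s hrs
  rcases eq_zero_or_pos s with rfl | hs
  · rw [nonpos_iff_eq_zero.1 hrs]
  · refine (h.map_le_div_mul hs hrs).trans (mul_le_of_le_one_left' ?_)
    exact_mod_cast div_le_one_of_le₀ hrs zero_le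

theorem IsYoungY.strictMono {Φ : ℝ≥0 → ℝ≥0∞} (h : IsYoungY Φ) : StrictMono Φ := by
  intro r s hrs
  have hs : 0 < s := zero_le.trans_lt hrs
  refine (h.1.map_le_div_mul hs hrs.le).trans_lt ?_
  have h1 : ((r / s : ℝ≥0) : ℝ≥0∞) < 1 := by exact_mod_cast (div_lt_one hs).2 hrs
  have := ENNReal.mul_lt_mul_left (h.2 s hs).1.ne' (h.2 s hs).2.ne h1
  rwa [one_mul] at this

theorem inverse_le_of_lt {F : ℝ≥0 → ℝ≥0∞} {s : ℝ≥0∞} {r : ℝ≥0} (h : s < F r) :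
    inverse F s ≤ r :=
  iInf₂_le r h

theorem le_inverse {F : ℝ≥0 → ℝ≥0∞} {s t : ℝ≥0∞} (h : ∀ r, s < F r → t ≤ r) :
    t ≤ inverse F s :=
  le_iInf₂ h

theorem map_le_of_lt_inverse {F : ℝ≥0 → ℝ≥0∞} {s : ℝ≥0∞} {r : ℝ≥0} (h : r < inverse F s) :
    F r ≤ s := by
  by_contra! hc
  exact absurd (inverse_le_of_lt hc) (not_le.2 h)

theorem inverse_mono (F : ℝ≥0 → ℝ≥0∞) : Monotone (inverse F) := fun _ _ hst =>
  le_inverse fun _ hr => inverse_le_of_lt (hst.trans_lt hr)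

theorem lt_map_of_inverse_lt {F : ℝ≥0 → ℝ≥0∞} (hF : Monotone F) {s : ℝ≥0∞} {r : ℝ≥0}
    (h : inverse F s < r) : s < F r := by
  simp only [inverse, iInf_lt_iff] at h
  obtain ⟨t, ht, htr⟩ := h
  exact ht.trans_le (hF (by exact_mod_cast htr.le))

theorem IsYoung.inverse_lt_top {Ψ : ℝ≥0 → ℝ≥0∞} (h : IsYoung Ψ) (x : ℝ≥0) :
    inverse Ψ x < ⊤ := by
  obtain ⟨r, hr⟩ := (h.tendsto_top.eventually (lt_mem_nhds (ENNReal.coe_lt_top (r := x)))).exists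
  exact (inverse_le_of_lt hr).trans_lt ENNReal.coe_lt_top

theorem IsYoung.inverse_pos {Ψ : ℝ≥0 → ℝ≥0∞} (h : IsYoung Ψ) {x : ℝ≥0} (hx : 0 < x) :
    0 < inverse Ψ x := by
  have hx' : (0 : ℝ≥0∞) < x := by exact_mod_cast hx
  have : (𝓝[>] (0 : ℝ≥0)).NeBot := nhdsGT_neBot_of_exists_gt ⟨1, one_pos⟩
  obtain ⟨r, hr, hr0⟩ :=
    ((h.tendsto_zero.eventually (gt_mem_nhds hx')).and self_mem_nhdsWithin).exists
  have hr0' : (0 : ℝ≥0∞) < r := by exact_mod_cast hr0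
  refine hr0'.trans_le (le_inverse fun s hs => ?_)
  exact_mod_cast (h.monotone.reflect_lt (hr.trans hs)).le

theorem IsYoung.exists_inverse_eq {Ψ : ℝ≥0 → ℝ≥0∞} (h : IsYoung Ψ) {x : ℝ≥0} (hx : 0 < x) :
    ∃ u : ℝ≥0, 0 < u ∧ inverse Ψ x = u := by
  refine ⟨(inverse Ψ x).toNNReal, ?_, (ENNReal.coe_toNNReal (h.inverse_lt_top x).ne).symm⟩
  exact ENNReal.toNNReal_pos (h.inverse_pos hx).ne' (h.inverse_lt_top x).ne

theorem IsYoungY.inverse_map {Φ : ℝ≥0 → ℝ≥0∞} (h : IsYoungY Φ) (w : ℝ≥0) :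
    w ≤ inverse Φ (Φ w) :=
  le_inverse fun r hr => by exact_mod_cast (h.strictMono.lt_iff_lt.1 hr).le

theorem IsYoungY.inverse_le_of_le {Φ : ℝ≥0 → ℝ≥0∞} (h : IsYoungY Φ) {x : ℝ≥0∞} {w : ℝ≥0}
    (hx : x ≤ Φ w) : inverse Φ x ≤ w := by
  refine le_of_forall_gt_imp_ge_of_dense fun t ht => ?_
  obtain ⟨s, hws, hst⟩ := ENNReal.lt_iff_exists_nnreal_btwn.1 ht
  have : w < s := by exact_mod_cast hws
  exact (inverse_le_of_lt (hx.trans_lt (h.strictMono this))).trans hst.le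

theorem IsYoungY.map_ne_top {Φ : ℝ≥0 → ℝ≥0∞} (h : IsYoungY Φ) (w : ℝ≥0) : Φ w ≠ ⊤ := by
  rcases eq_zero_or_pos w with rfl | hw
  · simp [h.1.map_zero]
  · exact (h.2 w hw).2.ne

/-! ### The weak-type condition -/

theorem rpow_neg_mul_le_iff {a : ℝ} {r : ℝ≥0} (hr : 0 < r) (x y : ℝ≥0∞) :
    (r : ℝ≥0∞) ^ (-a) * x ≤ y ↔ x ≤ (r : ℝ≥0∞) ^ a * y := by
  have hr' : (r : ℝ≥0∞) ≠ 0 := by exact_mod_cast hr.ne'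
  rw [ENNReal.rpow_neg, mul_comm, ← div_eq_mul_inv, ENNReal.div_le_iff_le_mul, mul_comm]
  · exact .inl (ENNReal.rpow_pos (pos_iff_ne_zero.2 hr') ENNReal.coe_ne_top).ne'
  · exact .inl (ENNReal.rpow_ne_top_of_ne_zero hr' ENNReal.coe_ne_top)

/-- Adams' condition, solved for `Φ⁻¹`. -/
theorem adamsCondition_iff {n : ℕ} {α : ℝ} {Φ Ψ : ℝ≥0 → ℝ≥0∞} :
    AdamsCondition n α Φ Ψ ↔ ∃ C : ℝ≥0, 0 < C ∧ ∀ r : ℝ≥0, 0 < r →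
      inverse Φ r ≤ C * ((r : ℝ≥0∞) ^ (α / n) * inverse Ψ r) := by
  refine exists_congr fun C => and_congr_right fun _ => forall₂_congr fun r hr => ?_
  rw [rpow_neg_mul_le_iff hr, mul_left_comm]

theorem cianchiWeak_iff {n : ℕ} {α : ℝ} (ha : 0 < α / n) {Φ Ψ : ℝ≥0 → ℝ≥0∞}
    (hΦ : IsYoungY Φ) (hΨ : IsYoung Ψ) :
    CianchiWeak n α Φ Ψ ↔ AdamsCondition n α Φ Ψ := by
  rw [adamsCondition_iff]
  constructor
  · rintro ⟨c, hc, H⟩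
    refine ⟨c, hc, fun r hr => ?_⟩
    obtain ⟨u, -, hu⟩ := hΨ.exists_inverse_eq hr
    have hQ : (r : ℝ≥0∞) ≤ Q (α / n) Ψ (r ^ (α / n) * u) := by
      refine le_inverse fun s hs => ?_
      by_contra! hsr
      refine absurd hs (not_lt.2 ?_)
      rw [ENNReal.coe_mul, ENNReal.coe_rpow_of_nonneg _ ha.le, ← hu]
      exact mul_le_mul' (ENNReal.rpow_le_rpow hsr.le ha.le) (inverse_mono Ψ hsr.le)
    have := hΦ.inverse_le_of_le (hQ.trans (H _))
    rwa [ENNReal.coe_mul, ENNReal.coe_mul, ENNReal.coe_rpow_of_nonneg _ ha.le, ← hu] at this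
  · rintro ⟨C, hC, H⟩
    -- The inverse is an infimum over a strict inequality. The factor 2 gives `2 s ≤ y ^ (α / n) *
    -- Ψ⁻¹(y)` at `y = Φ (2 C s)`, hence a strict bound on `s > 0`.
    refine ⟨2 * C, by positivity, fun s => ?_⟩
    rcases eq_zero_or_pos s with rfl | hs
    · simp only [Q, mul_zero, hΦ.1.map_zero, nonpos_iff_eq_zero]
      refine le_antisymm (le_of_forall_gt_imp_ge_of_dense fun t ht => ?_) zero_le
      obtain ⟨x, hx, hxt⟩ := ENNReal.lt_iff_exists_nnreal_btwn.1 ht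
      have hx0 : 0 < x := by exact_mod_cast hx
      refine (inverse_le_of_lt ?_).trans hxt.le
      exact ENNReal.mul_pos (ENNReal.rpow_pos hx ENNReal.coe_ne_top).ne' (hΨ.inverse_pos hx0).ne'
    · have hw : 0 < 2 * C * s := by positivity
      obtain ⟨y, hy'⟩ : ∃ y : ℝ≥0, Φ (2 * C * s) = y :=
        ⟨_, (ENNReal.coe_toNNReal (hΦ.map_ne_top _)).symm⟩
      have hy0 : 0 < y := by exact_mod_cast hy' ▸ (hΦ.2 _ hw).1
      have h1 := hΦ.inverse_map (2 * C * s)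
      rw [hy'] at h1
      replace h1 := h1.trans (H y hy0)
      rw [hy']
      refine inverse_le_of_lt ?_
      obtain ⟨u, -, hu⟩ := hΨ.exists_inverse_eq hy0
      simp only [hu, ← ENNReal.coe_rpow_of_nonneg _ ha.le] at h1 ⊢
      norm_cast at h1 ⊢
      rw [mul_comm 2 C, mul_assoc] at h1
      have h2 := le_of_mul_le_mul_left h1 hC
      refine lt_of_lt_of_le ?_ h2
      rw [two_mul]
      exact lt_add_of_pos_left _ hs

/-! ### Estimates for `calB` and `tildePsiP`; the strong condition implies (*) -/

theorem conjExponent_sub_one_eq {P : ℝ} (hP : 1 < P) :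
    P.conjExponent - 1 = P.conjExponent * P⁻¹ := by
  rw [Real.conjExponent]
  have : P - 1 ≠ 0 := by linarith
  field_simp
  ring

theorem one_lt_conjExponent {P : ℝ} (hP : 1 < P) : 1 < P.conjExponent :=
  (Real.HolderConjugate.conjExponent hP).symm.lt

theorem le_calB {P : ℝ} (hP : 1 < P) {Ψ : ℝ≥0 → ℝ≥0∞} (hΨ : Monotone Ψ) (t : ℝ≥0) :
    Ψ t / ((2 * t : ℝ≥0) : ℝ≥0∞) ^ (1 + P.conjExponent) * t ≤ calB P Ψ (2 * t) := by
  have hq := one_lt_conjExponent hP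
  calc Ψ t / ((2 * t : ℝ≥0) : ℝ≥0∞) ^ (1 + P.conjExponent) * t
      = ∫⁻ _ in Ioo (t : ℝ) ((2 * t : ℝ≥0) : ℝ),
          Ψ t / ((2 * t : ℝ≥0) : ℝ≥0∞) ^ (1 + P.conjExponent) := by
        rw [setLIntegral_const, Real.volume_Ioo]
        congr 1
        rw [NNReal.coe_mul, NNReal.coe_ofNat, two_mul, add_sub_cancel_right,
          ENNReal.ofReal_coe_nnreal]
    _ ≤ ∫⁻ x in Ioo (t : ℝ) ((2 * t : ℝ≥0) : ℝ),
          Ψ x.toNNReal / ENNReal.ofReal x ^ (1 + P.conjExponent) := by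
        refine setLIntegral_mono' measurableSet_Ioo fun x hx => ?_
        refine ENNReal.div_le_div (hΨ (NNReal.le_toNNReal_of_coe_le hx.1.le))
          (ENNReal.rpow_le_rpow ?_ (by linarith))
        rw [← ENNReal.ofReal_coe_nnreal]
        exact ENNReal.ofReal_le_ofReal hx.2.le
    _ ≤ _ := lintegral_mono_set (Ioo_subset_Ioo_left t.2)

theorem tildePsiP_integrand_mono {P : ℝ} (hP : 1 < P) (Ψ : ℝ≥0 → ℝ≥0∞) :
    Monotone fun r : ℝ≥0∞ => r ^ (P.conjExponent - 1) *
      (inverse (calB P Ψ) (r ^ P.conjExponent)) ^ P.conjExponent := by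
  have hq := one_lt_conjExponent hP
  intro r s hrs
  refine mul_le_mul' (ENNReal.rpow_le_rpow hrs (by linarith)) (ENNReal.rpow_le_rpow ?_ (by linarith))
  exact inverse_mono _ (ENNReal.rpow_le_rpow hrs (by linarith))

theorem mul_rpow_sub_one_mul {q : ℝ} (hq : 1 < q) (r : ℝ≥0) (x : ℝ≥0∞) :
    (r : ℝ≥0∞) * ((r : ℝ≥0∞) ^ (q - 1) * x ^ q) = (r * x) ^ q := by
  rw [ENNReal.mul_rpow_of_nonneg _ _ (by linarith), ← mul_assoc]
  congr 1
  nth_rw 1 [← ENNReal.rpow_one (r : ℝ≥0∞)]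
  rw [← ENNReal.rpow_add_of_nonneg _ _ (by norm_num) (by linarith)]
  congr 1
  ring

theorem tildePsiP_le {P : ℝ} (hP : 1 < P) (Ψ : ℝ≥0 → ℝ≥0∞) (r : ℝ≥0) :
    tildePsiP P Ψ r ≤
      (r * inverse (calB P Ψ) ((r : ℝ≥0∞) ^ P.conjExponent)) ^ P.conjExponent := by
  rw [← mul_rpow_sub_one_mul (one_lt_conjExponent hP), mul_comm]
  refine (setLIntegral_mono' measurableSet_Ioo fun x hx =>
    tildePsiP_integrand_mono hP Ψ (?_ : ENNReal.ofReal x ≤ r)).trans ?_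
  · rw [← ENNReal.ofReal_coe_nnreal]
    exact ENNReal.ofReal_le_ofReal hx.2.le
  · rw [setLIntegral_const, Real.volume_Ioo, sub_zero, ENNReal.ofReal_coe_nnreal]

/-- On `(r, 2r)` the monotone integrand is at least its value at `r`. -/
theorem le_tildePsiP {P : ℝ} (hP : 1 < P) (Ψ : ℝ≥0 → ℝ≥0∞) (r : ℝ≥0) :
    (r * inverse (calB P Ψ) ((r : ℝ≥0∞) ^ P.conjExponent)) ^ P.conjExponent ≤
      tildePsiP P Ψ (2 * r) := by
  rw [← mul_rpow_sub_one_mul (one_lt_conjExponent hP), mul_comm]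
  refine le_trans ?_ (lintegral_mono_set (Ioo_subset_Ioo_left r.2))
  refine le_trans ?_ (setLIntegral_mono' measurableSet_Ioo fun x hx =>
    tildePsiP_integrand_mono hP Ψ (?_ : (r : ℝ≥0∞) ≤ ENNReal.ofReal x))
  · rw [setLIntegral_const, Real.volume_Ioo, NNReal.coe_mul, NNReal.coe_ofNat, two_mul]
    rw [NNReal.val_eq_coe, add_sub_cancel_right, ENNReal.ofReal_coe_nnreal]
  · rw [← ENNReal.ofReal_coe_nnreal]
    exact ENNReal.ofReal_le_ofReal hx.1.le

theorem le_PsiP {P : ℝ} (hP : 1 < P) {Ψ : ℝ≥0 → ℝ≥0∞} (hΨ : IsYoung Ψ) {x u : ℝ≥0}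
    (hx : 0 < x) (hu : 0 < u) (hxu : inverse Ψ x = u) : x ≤ PsiP P Ψ (16 * (x ^ P⁻¹ * u)) := by
  have hq := one_lt_conjExponent hP
  have hqa := conjExponent_sub_one_eq hP
  set q := P.conjExponent with hqdef
  have hq1 : (1 - P⁻¹) * q = 1 := by linarith
  -- The test point for the conjugate. Here `r ^ q = x / (8u) ^ q` lies below `calB P Ψ (4u)`, so
  -- `Θ(r) ≤ (4ur)^q ≤ x`, while the linear term equals `2x`.
  set r : ℝ≥0 := x ^ (1 - P⁻¹) / (8 * u) with hr
  have hΨu : (x : ℝ≥0∞) < Ψ (2 * u) := by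
    refine lt_map_of_inverse_lt hΨ.monotone ?_
    rw [hxu, two_mul]
    exact_mod_cast lt_add_of_pos_left _ hu
  have hrq : r ^ q = x / (8 * u) ^ q := by
    rw [hr, NNReal.div_rpow, ← NNReal.rpow_mul, hq1, NNReal.rpow_one]
  have hB : (r : ℝ≥0∞) ^ q < calB P Ψ (4 * u) := by
    have h1 := le_calB hP hΨ.monotone (2 * u)
    rw [← mul_assoc, show (2 : ℝ≥0) * 2 = 4 by norm_num] at h1
    refine lt_of_lt_of_le ?_ ((mul_le_mul_left (ENNReal.div_le_div_right hΨu.le _) _).trans h1)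
    rw [← ENNReal.coe_rpow_of_nonneg _ (by linarith), ← ENNReal.coe_rpow_of_nonneg _ (by linarith),
      ← ENNReal.coe_div (by positivity), ← ENNReal.coe_mul, ENNReal.coe_lt_coe, hrq]
    have h2 : x / (4 * u) ^ (1 + q) * (2 * u) = x / (2 * (4 * u) ^ q) := by
      rw [NNReal.rpow_add (by positivity), NNReal.rpow_one]
      field_simp
      norm_num
    rw [h2, show 8 * u = 2 * (4 * u) by ring, NNReal.mul_rpow (x := 2)]
    have h3 : (2 : ℝ≥0) < 2 ^ q := by
      simpa using NNReal.rpow_lt_rpow_of_exponent_lt (x := 2) (by norm_num) hq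
    have h4 : 0 < (4 * u) ^ q := by positivity
    gcongr
  have hT : tildePsiP P Ψ r ≤ x := by
    refine (tildePsiP_le hP Ψ r).trans ?_
    refine (ENNReal.rpow_le_rpow (mul_le_mul_right (inverse_le_of_lt hB) _) (by linarith)).trans ?_
    rw [← ENNReal.coe_mul, ← ENNReal.coe_rpow_of_nonneg _ (by linarith), ENNReal.coe_le_coe,
      NNReal.mul_rpow, hrq, div_mul_eq_mul_div, mul_div_assoc]
    refine mul_le_of_le_one_right' (div_le_one_of_le₀ ?_ zero_le)
    refine NNReal.rpow_le_rpow ?_ (by linarith)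
    gcongr
    norm_num
  refine le_trans ?_ (le_iSup _ r)
  refine le_trans ?_ (tsub_le_tsub_left hT _)
  rw [← ENNReal.coe_mul, ← ENNReal.coe_sub, ENNReal.coe_le_coe]
  have : 16 * (x ^ P⁻¹ * u) * r = x + x := by
    have h5 : x ^ P⁻¹ * x ^ (1 - P⁻¹) = x := by
      rw [← NNReal.rpow_add hx.ne', add_sub_cancel, NNReal.rpow_one]
    calc 16 * (x ^ P⁻¹ * u) * r = 2 * (x ^ P⁻¹ * x ^ (1 - P⁻¹)) := by
          rw [hr]; field_simp; norm_num
      _ = x + x := by rw [h5, two_mul]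
  rw [this, add_tsub_cancel_right]

theorem adamsCondition_of_dominatesGlobally_PsiP {n : ℕ} {α : ℝ} (hα : 0 < α) (hαn : α < n)
    {Φ Ψ : ℝ≥0 → ℝ≥0∞} (hΦ : IsYoungY Φ) (hΨ : IsYoung Ψ)
    (h : DominatesGlobally Φ (PsiP (n / α) Ψ)) : AdamsCondition n α Φ Ψ := by
  rw [adamsCondition_iff]
  obtain ⟨c, hc, H⟩ := h
  refine ⟨c * 16, by positivity, fun x hx => ?_⟩
  obtain ⟨u, hu, hxu⟩ := hΨ.exists_inverse_eq hx
  have h1 := (le_PsiP ((one_lt_div hα).2 hαn) hΨ hx hu hxu).trans (H _)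
  have h2 := hΦ.inverse_le_of_le h1
  rw [inv_div] at h2
  rw [hxu, ← ENNReal.coe_rpow_of_ne_zero hx.ne']
  exact_mod_cast (mul_assoc c 16 (x ^ (α / n) * u)).symm ▸ h2

/-! ### (*) and ∇₂ imply the strong condition -/

/-- With `M = D^q 2^(q-1)` one has `(2D)^q = 2M`, so this is ∇₂ with constant `M`; convexity allows
the constant to be enlarged from `C` to `M`. -/
theorem Nabla2.exists_le {Φ : ℝ≥0 → ℝ≥0∞} (hΦ : IsYoung Φ) (h : Nabla2 Φ) {q : ℝ} (hq : 1 < q) :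
    ∃ D : ℝ≥0, 2 ≤ D ∧ ∀ r : ℝ≥0,
      Φ r ≤ ((((2 * D) ^ q)⁻¹ : ℝ≥0) : ℝ≥0∞) * Φ (D ^ q * 2 ^ (q - 1) * r) := by
  obtain ⟨C, hC, H⟩ := h
  have hC0 : 0 < C := one_pos.trans hC
  refine ⟨max 2 C, le_max_left _ _, fun r => ?_⟩
  set D := max 2 C with hD
  have hD0 : 0 < D := by positivity
  set M : ℝ≥0 := D ^ q * 2 ^ (q - 1) with hM
  have hM0 : 0 < M := by positivity
  have hCM : C ≤ M := by
    have h1 : 1 ≤ D := le_trans (by norm_num) (le_max_left 2 C)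
    calc C ≤ D := le_max_right _ _
      _ = D ^ (1 : ℝ) * 1 := by simp
      _ ≤ D ^ q * 2 ^ (q - 1) :=
        mul_le_mul' (NNReal.rpow_le_rpow_of_exponent_le h1 hq.le)
          (NNReal.one_le_rpow (by norm_num) (by linarith))
  have h2M : (2 * D) ^ q = 2 * M := by
    rw [hM, NNReal.mul_rpow, mul_left_comm, mul_comm]
    congr 1
    nth_rw 2 [← NNReal.rpow_one 2]
    rw [← NNReal.rpow_add (by norm_num)]
    congr 1
    ring
  have h3 : (1 / (2 * (C : ℝ≥0∞))) = ((2 * C)⁻¹ : ℝ≥0) := by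
    rw [ENNReal.coe_inv (by positivity), ENNReal.coe_mul, one_div]
    rfl
  have h4 := hΦ.map_mul_le (div_le_one_of_le₀ hCM zero_le) (M * r)
  rw [← mul_assoc, div_mul_cancel₀ _ hM0.ne'] at h4
  refine (H r).trans ((mul_le_mul_right h4 _).trans (le_of_eq ?_))
  rw [h3, h2M, ← mul_assoc, ← ENNReal.coe_mul]
  congr 2
  field_simp

theorem le_pow_mul_of_le_mul {Φ : ℝ≥0 → ℝ≥0∞} {A : ℝ≥0∞} {M : ℝ≥0}
    (h : ∀ r, Φ r ≤ A * Φ (M * r)) (k : ℕ) (r : ℝ≥0) : Φ r ≤ A ^ k * Φ (M ^ k * r) := by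
  induction k with
  | zero => simp
  | succ k ih =>
    refine ih.trans ((mul_le_mul_right (h _) _).trans (le_of_eq ?_))
    rw [pow_succ, pow_succ', mul_assoc, mul_assoc]

/-- A geometric decay estimate for `Ψ` at the points `t D⁻ᵏ`. -/
theorem geometric_decay {P : ℝ} (hP : 1 < P) {Φ Ψ : ℝ≥0 → ℝ≥0∞} (hΦ : IsYoung Φ)
    (hΨ : IsYoung Ψ) {C D : ℝ≥0} (hC : 0 < C) (hD : 2 ≤ D)
    (hA : ∀ r : ℝ≥0, 0 < r → inverse Φ r < C * ((r : ℝ≥0∞) ^ P⁻¹ * inverse Ψ r))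
    (hN : ∀ r : ℝ≥0, Φ r ≤ ((((2 * D) ^ P.conjExponent)⁻¹ : ℝ≥0) : ℝ≥0∞) *
      Φ (D ^ P.conjExponent * 2 ^ (P.conjExponent - 1) * r))
    {w y : ℝ≥0} (hy : 0 < y) (hwy : Φ w = y) (k : ℕ) {u : ℝ≥0}
    (hu : u ≤ w / (C * y ^ P⁻¹) * D⁻¹ ^ k) :
    Ψ u ≤ ((y * ((2 * D) ^ P.conjExponent)⁻¹ ^ k : ℝ≥0) : ℝ≥0∞) := by
  have hq := one_lt_conjExponent hP
  have hqa := conjExponent_sub_one_eq hP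
  set q := P.conjExponent with hqdef
  have hD0 : 0 < D := lt_of_lt_of_le (by norm_num) hD
  set M : ℝ≥0 := D ^ q * 2 ^ (q - 1) with hM
  have hM0 : 0 < M := by positivity
  set z : ℝ≥0 := y * ((2 * D) ^ q)⁻¹ ^ k with hz
  have hz0 : 0 < z := by positivity
  have h1 : Φ (M⁻¹ ^ k * w) ≤ z := by
    refine (le_pow_mul_of_le_mul hN k _).trans (le_of_eq ?_)
    rw [← mul_assoc, ← mul_pow, mul_inv_cancel₀ hM0.ne', one_pow, one_mul, hwy, hz, mul_comm]
    push_cast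
    rfl
  have h2 : ((M⁻¹ ^ k * w : ℝ≥0) : ℝ≥0∞) ≤ inverse Φ z :=
    le_inverse fun r hr => by exact_mod_cast (hΦ.monotone.reflect_lt (h1.trans_lt hr)).le
  have h3 := h2.trans_lt (hA z hz0)
  obtain ⟨v, -, hv⟩ := hΨ.exists_inverse_eq hz0
  rw [hv, ← ENNReal.coe_rpow_of_ne_zero hz0.ne', ← ENNReal.coe_mul, ← ENNReal.coe_mul,
    ENNReal.coe_lt_coe, ← mul_assoc] at h3
  refine map_le_of_lt_inverse ?_
  rw [hv, ENNReal.coe_lt_coe]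
  refine hu.trans_lt ?_
  -- The choice of `M` pays off here: passing to the next scale divides the lower bound for `Φ⁻¹` by
  -- `M` and `z ^ P⁻¹` by `(2D)^(q/P)`, so their quotient shrinks by exactly `D`.
  have h4 : M = D * ((2 * D) ^ q) ^ P⁻¹ := by
    rw [← NNReal.rpow_mul, ← hqa, NNReal.mul_rpow, hM, mul_left_comm, mul_comm]
    congr 1
    nth_rw 2 [← NNReal.rpow_one D]
    rw [← NNReal.rpow_add hD0.ne']
    congr 1
    ring
  have h5 : z ^ P⁻¹ = y ^ P⁻¹ * (((2 * D) ^ q) ^ P⁻¹)⁻¹ ^ k := by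
    rw [hz, NNReal.mul_rpow, ← NNReal.rpow_natCast, ← NNReal.rpow_mul, mul_comm (k : ℝ),
      NNReal.rpow_mul, NNReal.rpow_natCast, NNReal.inv_rpow]
  have h6 : w / (C * y ^ P⁻¹) * D⁻¹ ^ k = M⁻¹ ^ k * w / (C * z ^ P⁻¹) := by
    rw [h5, h4]
    have : 0 < ((2 * D) ^ q) ^ P⁻¹ := by positivity
    generalize ((2 * D) ^ q) ^ P⁻¹ = E at this
    simp only [inv_pow, mul_pow]
    field_simp
  rw [h6]
  exact (div_lt_iff₀' (by positivity)).2 h3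

theorem calB_mono (P : ℝ) (Ψ : ℝ≥0 → ℝ≥0∞) : Monotone (calB P Ψ) := fun _ _ hst =>
  lintegral_mono_set (Ioo_subset_Ioo_right (by exact_mod_cast hst))

/-- On `(t D⁻ᵏ⁻¹, t D⁻ᵏ]` the weight costs a factor `D^(qk)`, leaving `2^(-qk) ≤ 2⁻ᵏ` from the decay
of `Ψ`. -/
theorem calB_le_of_geometric_decay {P : ℝ} (hP : 1 < P) {Ψ : ℝ≥0 → ℝ≥0∞} {D t y : ℝ≥0}
    (hD : 2 ≤ D) (ht : 0 < t)
    (h : ∀ (k : ℕ) (u : ℝ≥0), u ≤ t * D⁻¹ ^ k →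
      Ψ u ≤ ((y * ((2 * D) ^ P.conjExponent)⁻¹ ^ k : ℝ≥0) : ℝ≥0∞)) :
    calB P Ψ t ≤ ((2 * D ^ (1 + P.conjExponent) * (y / t ^ P.conjExponent) : ℝ≥0) : ℝ≥0∞) := by
  have hq := one_lt_conjExponent hP
  set q := P.conjExponent with hqdef
  have hD0 : 0 < D := lt_of_lt_of_le (by norm_num) hD
  have hD1 : D⁻¹ < 1 := inv_lt_one_of_one_lt₀ (lt_of_lt_of_le (by norm_num) hD)
  set f : ℝ → ℝ≥0∞ := fun x => Ψ x.toNNReal / ENNReal.ofReal x ^ (1 + q) with hf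
  set S : ℕ → Set ℝ := fun k =>
    Ioc ((t * D⁻¹ ^ (k + 1) : ℝ≥0) : ℝ) ((t * D⁻¹ ^ k : ℝ≥0) : ℝ) with hS
  have hcover : Ioo (0 : ℝ) t ⊆ ⋃ k, S k := by
    intro x hx
    lift x to ℝ≥0 using hx.1.le
    have hx0 : 0 < x := by exact_mod_cast hx.1
    have hxt : x < t := by exact_mod_cast hx.2
    obtain ⟨k, hk1, hk2⟩ := exists_nat_pow_near_of_lt_one (div_pos hx0 ht)
      ((div_le_one ht).2 hxt.le) (inv_pos.2 hD0) hD1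
    refine mem_iUnion.2 ⟨k, ?_, ?_⟩
    · exact_mod_cast (lt_div_iff₀' ht).1 hk1
    · exact_mod_cast (div_le_iff₀' ht).1 hk2
  have hpiece (k : ℕ) : ∫⁻ x in S k, f x ≤
      ((D ^ (1 + q) * (y / t ^ q) : ℝ≥0) : ℝ≥0∞) * 2⁻¹ ^ k := by
    have hlow : 0 < t * D⁻¹ ^ (k + 1) := by positivity
    calc ∫⁻ x in S k, f x
        ≤ ∫⁻ _ in S k, ((y * ((2 * D) ^ q)⁻¹ ^ k / (t * D⁻¹ ^ (k + 1)) ^ (1 + q) : ℝ≥0) :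
            ℝ≥0∞) := by
          refine setLIntegral_mono' measurableSet_Ioc fun x hx => ?_
          rw [ENNReal.coe_div (by positivity), ENNReal.coe_rpow_of_nonneg _ (by linarith)]
          refine ENNReal.div_le_div (h k _ (Real.toNNReal_le_iff_le_coe.2 hx.2))
            (ENNReal.rpow_le_rpow ?_ (by linarith))
          rw [← ENNReal.ofReal_coe_nnreal]
          exact ENNReal.ofReal_le_ofReal hx.1.le
      _ ≤ ((y * ((2 * D) ^ q)⁻¹ ^ k / (t * D⁻¹ ^ (k + 1)) ^ (1 + q) : ℝ≥0) : ℝ≥0∞) *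
            ((t * D⁻¹ ^ k : ℝ≥0) : ℝ≥0∞) := by
          rw [setLIntegral_const, Real.volume_Ioc]
          refine mul_le_mul_right ?_ _
          rw [← ENNReal.ofReal_coe_nnreal]
          exact ENNReal.ofReal_le_ofReal (sub_le_self _ (NNReal.coe_nonneg _))
      _ ≤ _ := by
          have h2 : (2⁻¹ : ℝ≥0∞) = ((2⁻¹ : ℝ≥0) : ℝ≥0∞) := by
            rw [ENNReal.coe_inv (by norm_num)]; rfl
          rw [h2, ← ENNReal.coe_pow, ← ENNReal.coe_mul, ← ENNReal.coe_mul, ENNReal.coe_le_coe]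
          have hpow : (D⁻¹ ^ k) ^ q = (D ^ q)⁻¹ ^ k := by
            rw [← NNReal.rpow_natCast, ← NNReal.rpow_mul, mul_comm (k : ℝ), NNReal.rpow_mul,
              NNReal.rpow_natCast, NNReal.inv_rpow]
          have h3 : (2 ^ q : ℝ≥0)⁻¹ ≤ 2⁻¹ := by
            refine inv_anti₀ (by norm_num) ?_
            simpa using NNReal.rpow_le_rpow_of_exponent_le (x := 2) (by norm_num) hq.le
          calc y * ((2 * D) ^ q)⁻¹ ^ k / (t * D⁻¹ ^ (k + 1)) ^ (1 + q) * (t * D⁻¹ ^ k)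
              = D ^ (1 + q) * (y / t ^ q) * (2 ^ q)⁻¹ ^ k := by
                rw [pow_succ, ← mul_assoc t (D⁻¹ ^ k) D⁻¹, NNReal.mul_rpow (x := t * D⁻¹ ^ k),
                  NNReal.rpow_add (x := t * D⁻¹ ^ k) (by positivity), NNReal.rpow_one,
                  NNReal.mul_rpow (x := t), hpow, NNReal.mul_rpow (x := 2), NNReal.inv_rpow]
                have : 0 < D ^ q := by positivity
                have : 0 < D ^ (1 + q) := by positivity
                have : 0 < t ^ q := by positivity
                have : (0 : ℝ≥0) < 2 ^ q := by positivity
                simp only [inv_pow, mul_pow]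
                field_simp
            _ ≤ _ := mul_le_mul_right (pow_le_pow_left' h3 k) _
  calc calB P Ψ t ≤ ∫⁻ x in ⋃ k, S k, f x := lintegral_mono_set hcover
    _ ≤ ∑' k, ∫⁻ x in S k, f x := lintegral_iUnion_le _ _
    _ ≤ ∑' k : ℕ, ((D ^ (1 + q) * (y / t ^ q) : ℝ≥0) : ℝ≥0∞) * 2⁻¹ ^ k :=
        ENNReal.tsum_le_tsum hpiece
    _ = _ := by
        rw [ENNReal.tsum_mul_left, ENNReal.tsum_geometric, ENNReal.one_sub_inv_two, inv_inv,
          mul_comm, mul_assoc, ENNReal.coe_mul]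
        rfl

theorem calB_le {P : ℝ} (hP : 1 < P) {Φ Ψ : ℝ≥0 → ℝ≥0∞} (hΦ : IsYoung Φ)
    (hΨ : IsYoung Ψ) {C D : ℝ≥0} (hC : 0 < C) (hD : 2 ≤ D)
    (hA : ∀ r : ℝ≥0, 0 < r → inverse Φ r < C * ((r : ℝ≥0∞) ^ P⁻¹ * inverse Ψ r))
    (hN : ∀ r : ℝ≥0, Φ r ≤ ((((2 * D) ^ P.conjExponent)⁻¹ : ℝ≥0) : ℝ≥0∞) *
      Φ (D ^ P.conjExponent * 2 ^ (P.conjExponent - 1) * r))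
    {w y : ℝ≥0} (hw : 0 < w) (hy : 0 < y) (hwy : Φ w = y) :
    calB P Ψ (w / (C * y ^ P⁻¹)) ≤
      ((2 * D ^ (1 + P.conjExponent) * (C * y / w) ^ P.conjExponent : ℝ≥0) : ℝ≥0∞) := by
  refine (calB_le_of_geometric_decay hP hD (by positivity) fun k u hu =>
    geometric_decay hP hΦ hΨ hC hD hA hN hy hwy k hu).trans (le_of_eq ?_)
  congr 2
  have hyq : y ^ P.conjExponent = y * (y ^ P⁻¹) ^ P.conjExponent := by
    rw [← NNReal.rpow_mul, mul_comm P⁻¹, ← conjExponent_sub_one_eq hP]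
    nth_rw 2 [← NNReal.rpow_one y]
    rw [← NNReal.rpow_add hy.ne', add_sub_cancel]
  rw [NNReal.div_rpow, NNReal.div_rpow, NNReal.mul_rpow, NNReal.mul_rpow, hyq, div_div_eq_mul_div]
  ring

theorem PsiP_le {P : ℝ} (hP : 1 < P) {Φ Ψ : ℝ≥0 → ℝ≥0∞} (hΦ : IsYoungY Φ)
    (hΨ : IsYoung Ψ) {C D : ℝ≥0} (hC : 0 < C) (hD : 2 ≤ D)
    (hA : ∀ r : ℝ≥0, 0 < r → inverse Φ r < C * ((r : ℝ≥0∞) ^ P⁻¹ * inverse Ψ r))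
    (hN : ∀ r : ℝ≥0, Φ r ≤ ((((2 * D) ^ P.conjExponent)⁻¹ : ℝ≥0) : ℝ≥0∞) *
      Φ (D ^ P.conjExponent * 2 ^ (P.conjExponent - 1) * r)) (s : ℝ≥0) :
    PsiP P Ψ s ≤ Φ (2 * C * (2 * D ^ (1 + P.conjExponent)) * s) := by
  have hq := one_lt_conjExponent hP
  have hqa := conjExponent_sub_one_eq hP
  rcases eq_zero_or_pos s with rfl | hs
  · simp [PsiP, conjugate]
  set q := P.conjExponent with hqdef
  have hD0 : 0 < D := lt_of_lt_of_le (by norm_num) hD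
  set K : ℝ≥0 := 2 * D ^ (1 + q) with hK
  have hK1 : 1 ≤ K := one_le_mul (by norm_num)
    (NNReal.one_le_rpow (le_trans (by norm_num) hD) (by linarith))
  have hK0 : 0 < K := one_pos.trans_le hK1
  set w : ℝ≥0 := 2 * C * K * s with hw
  have hw0 : 0 < w := by positivity
  obtain ⟨y, hwy⟩ : ∃ y : ℝ≥0, Φ w = y := ⟨_, (ENNReal.coe_toNNReal (hΦ.map_ne_top _)).symm⟩
  have hy : 0 < y := by exact_mod_cast hwy ▸ (hΦ.2 w hw0).1
  refine iSup_le fun r => ?_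
  rw [hwy, tsub_le_iff_right]
  -- The claim is now `s r ≤ y + Θ(r)`. If `s r > y`, then `C y / w < r / (2K)`, so `𝓑(t) ≤ (r/2)^q`
  -- and `Θ(r) ≥ (r t / 2)^q ≥ s r`.
  rcases le_or_gt (s * r) y with hr | hr
  · exact le_add_right (by exact_mod_cast hr)
  refine le_add_left ?_
  set t : ℝ≥0 := w / (C * y ^ P⁻¹) with ht
  have hB : calB P Ψ t ≤ (((r / 2 : ℝ≥0) : ℝ≥0∞) ^ q) := by
    refine (calB_le hP hΦ.1 hΨ hC hD hA hN hw0 hy hwy).trans ?_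
    rw [← ENNReal.coe_rpow_of_nonneg _ (by linarith), ENNReal.coe_le_coe, ← hK]
    have h1 : C * y / w ≤ r / 2 / K := by
      rw [hw, div_div, div_le_div_iff₀ (by positivity) (by positivity)]
      calc C * y * (2 * K) ≤ C * (s * r) * (2 * K) := by gcongr
        _ = r * (2 * C * K * s) := by ring
    calc K * (C * y / w) ^ q ≤ K * (r / 2 / K) ^ q := by gcongr
      _ = (r / 2) ^ q * (K / K ^ q) := by rw [NNReal.div_rpow (r / 2)]; ring
      _ ≤ (r / 2) ^ q := by
        refine mul_le_of_le_one_right' (div_le_one_of_le₀ ?_ zero_le)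
        simpa using NNReal.rpow_le_rpow_of_exponent_le hK1 hq.le
  have hinv : (t : ℝ≥0∞) ≤ inverse (calB P Ψ) (((r / 2 : ℝ≥0) : ℝ≥0∞) ^ q) :=
    le_inverse fun v hv => by exact_mod_cast ((calB_mono P Ψ).reflect_lt (hB.trans_lt hv)).le
  have hT := le_tildePsiP hP Ψ (r / 2)
  rw [mul_div_cancel₀ _ (by norm_num : (2 : ℝ≥0) ≠ 0)] at hT
  refine le_trans ?_ ((ENNReal.rpow_le_rpow (mul_le_mul_right hinv _) (by linarith)).trans hT)
  rw [← ENNReal.coe_mul, ← ENNReal.coe_mul, ← ENNReal.coe_rpow_of_nonneg _ (by linarith),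
    ENNReal.coe_le_coe]
  have hsr : 0 < s * r := hy.trans hr
  have h2 : (y ^ P⁻¹) ^ q = y ^ (q - 1) := by rw [← NNReal.rpow_mul, mul_comm P⁻¹, ← hqa]
  have h3 : r / 2 * t = K * (s * r) / y ^ P⁻¹ := by
    rw [ht, hw]
    field_simp
  rw [h3, NNReal.div_rpow, h2, le_div_iff₀ (by positivity)]
  calc s * r * y ^ (q - 1) ≤ s * r * (s * r) ^ (q - 1) :=
        mul_le_mul_right (NNReal.rpow_le_rpow hr.le (by linarith)) _
    _ = (s * r) ^ q := by
        nth_rw 1 [← NNReal.rpow_one (s * r)]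
        rw [← NNReal.rpow_add hsr.ne', add_sub_cancel]
    _ ≤ (K * (s * r)) ^ q := NNReal.rpow_le_rpow (le_mul_of_one_le_left' hK1) (by linarith)

theorem cianchiStrong_of_adamsCondition {n : ℕ} {α : ℝ} (hα : 0 < α) (hαn : α < n)
    {Φ Ψ : ℝ≥0 → ℝ≥0∞} (hΦ : IsYoungY Φ) (hΨ : IsYoung Ψ) (hN : Nabla2 Φ)
    (h : AdamsCondition n α Φ Ψ) : CianchiStrong n α Φ Ψ := by
  have hP : 1 < n / α := (one_lt_div hα).2 hαn
  obtain ⟨C, hC, H⟩ := adamsCondition_iff.1 h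
  obtain ⟨D, hD, hDN⟩ := hN.exists_le hΦ.1 (one_lt_conjExponent hP)
  -- Doubling `C` makes the inequality strict, as needed to bound `Ψ` strictly below its inverse.
  have hA : ∀ r : ℝ≥0, 0 < r →
      inverse Φ r < ((2 * C : ℝ≥0) : ℝ≥0∞) * ((r : ℝ≥0∞) ^ (n / α)⁻¹ * inverse Ψ r) := by
    intro r hr
    refine (H r hr).trans_lt ?_
    obtain ⟨u, hu, hru⟩ := hΨ.exists_inverse_eq hr
    rw [inv_div, hru, ← ENNReal.coe_rpow_of_ne_zero hr.ne', ← ENNReal.coe_mul, ← ENNReal.coe_mul,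
      ← ENNReal.coe_mul, ENNReal.coe_lt_coe]
    gcongr
    rw [two_mul]
    exact lt_add_of_pos_left _ hC
  have hC2 : 0 < 2 * C := by positivity
  have hD0 : 0 < D := lt_of_lt_of_le (by norm_num) hD
  refine ⟨?_, _, ?_, PsiP_le hP hΦ hΨ hC2 hD hA hDN⟩
  · obtain ⟨y, hwy⟩ : ∃ y : ℝ≥0, Φ 1 = y := ⟨_, (ENNReal.coe_toNNReal (hΦ.map_ne_top _)).symm⟩
    have hy : 0 < y := by exact_mod_cast hwy ▸ (hΦ.2 1 one_pos).1
    have hB := (calB_le hP hΦ.1 hΨ hC2 hD hA hDN one_pos hy hwy).trans_lt ENNReal.coe_lt_top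
    refine ⟨((1 / (2 * C * y ^ (n / α : ℝ)⁻¹) : ℝ≥0) : ℝ), by positivity, lt_of_eq_of_lt ?_ hB⟩
    have hexp : (n : ℝ) / (n - α) = (n / α : ℝ).conjExponent := by
      have : (n : ℝ) - α ≠ 0 := by linarith
      rw [Real.conjExponent, ← div_self hα.ne', ← sub_div, div_div_div_cancel_right₀ hα.ne']
    rw [hexp]
    rfl
  · positivity

end Orlicz

theorem mainTheorem7 (n : ℕ) (α : ℝ) (hα : 0 < α) (hαn : α < n)
    (Φ Ψ : ℝ≥0 → ℝ≥0∞) (hΦ : Orlicz.IsYoungY Φ) (hΨ : Orlicz.IsYoung Ψ) :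
    (Orlicz.CianchiWeak n α Φ Ψ ↔ Orlicz.AdamsCondition n α Φ Ψ) ∧
    (Orlicz.Nabla2 Φ →
      (Orlicz.CianchiStrong n α Φ Ψ ↔ Orlicz.AdamsCondition n α Φ Ψ)) :=
  ⟨Orlicz.cianchiWeak_iff (div_pos hα (hα.trans hαn)) hΦ hΨ, fun hN =>
    ⟨fun h => Orlicz.adamsCondition_of_dominatesGlobally_PsiP hα hαn hΦ hΨ h.2,
      Orlicz.cianchiStrong_of_adamsCondition hα hαn hΦ hΨ hN⟩⟩
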